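/- Let $P$ be a smooth manifold of dimension $n$ (Hausdorff, without boundary; second countability is not needed). A subset $S\subset P$ is a smooth $d$-dimensional submanifold, $0\le d\le n$, if around each point of $S$ there is a smooth chart $\varphi:U\to\mathbb{R}^n$ of $P$ with $S\cap U=\{y\in U:\varphi_{d+1}(y)=\dots=\varphi_n(y)=0\}$. Let $\Sigma\subset P$ be a closed subset that is a submanifold-complex, i.e. a set with a stratification $\Sigma=\Sigma_1\sqcup\dots\sqcup\Sigma_k$ into finitely many non-empty, pairwise disjoint smooth submanifolds of $P$ (the strata); no condition on the way the strata fit together is needed. The dimension of $\Sigma$ is the maximum of the dimensions of its strata ($-\infty$ if $\Sigma=\emptyset$). Suppose that $\Sigma$ has codimension at least two, i.e. $\dim\Sigma\le n-2$. Then, for every ring $R$ and every left $R$-module $M$, the inclusion $P\setminus\Sigma\hookrightarrow P$ induces an isomorphism $$H_0(P\setminus\Sigma;M)\xrightarrow{\ \cong\ }H_0(P;M)$$ on the zeroth singular homology. Consequently $\Sigma$ does not disconnect $P$: for every connected component $K$ of $P$, the set $K\setminus\Sigma$ is non-empty and connected; in particular, if $P$ is connected, so is $P\setminus\Sigma$.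 -/

import Mathlib

universe u v w

open CategoryTheory AlgebraicTopology
open scoped Manifold ContDiff

/-- A subset `S` of a smooth `n`-manifold `P` is a smooth (embedded, not necessarily closed)
`d`-dimensional submanifold: around each of its points there is a smooth chart of `P` in which
`S` is cut out by the vanishing of the last `n - d` coordinates. -/
def IsSmoothSubmanifold (n : ℕ) {P : Type*} [TopologicalSpace P]
    [ChartedSpace (EuclideanSpace ℝ (Fin n)) P] (d : ℕ) (S : Set P) : Prop :=
  d ≤ n ∧ ∀ x ∈ S, ∃ φ ∈ IsManifold.maximalAtlas (𝓡 n) ∞ P, x ∈ φ.source ∧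
    ∀ y ∈ φ.source, y ∈ S ↔ ∀ i : Fin n, d ≤ (i : ℕ) → φ y i = 0

/-- The structure of a submanifold-complex on a subset `S` of a smooth `n`-manifold `P`: a
stratification of `S`, i.e. a partition of `S` into finitely many nonempty smooth submanifolds
of `P`, the strata. Nothing is required of the way the strata fit together, so stratifications
with a frontier condition or with Whitney's conditions are included. -/
structure SubmanifoldComplex (n : ℕ) {P : Type*} [TopologicalSpace P]
    [ChartedSpace (EuclideanSpace ℝ (Fin n)) P] (S : Set P) where
  /-- the number of strata -/
  card : ℕ
  /-- the strata -/
  stratum : Fin card → Set P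
  /-- the dimensions of the strata -/
  stratumDim : Fin card → ℕ
  isSmoothSubmanifold : ∀ i, IsSmoothSubmanifold n (stratumDim i) (stratum i)
  nonempty : ∀ i, (stratum i).Nonempty
  pairwise_disjoint : Pairwise fun i j => Disjoint (stratum i) (stratum j)
  iUnion_stratum : ⋃ i, stratum i = S

/-- The dimension of a submanifold-complex: the maximum of the dimensions of its strata
(`⊥` for the empty complex). -/
def SubmanifoldComplex.dim {n : ℕ} {P : Type*} [TopologicalSpace P]
    [ChartedSpace (EuclideanSpace ℝ (Fin n)) P] {S : Set P} (C : SubmanifoldComplex n S) :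
    WithBot ℕ :=
  Finset.univ.sup fun i => (C.stratumDim i : WithBot ℕ)

/-- The inclusion `P ∖ S ↪ P`, as a morphism of topological spaces. -/
def complInclusion {P : Type*} [TopologicalSpace P] (S : Set P) :
    TopCat.of ↥(Sᶜ) ⟶ TopCat.of P :=
  TopCat.ofHom ⟨Subtype.val, continuous_subtype_val⟩

/-!
The stratification enters only through Hausdorff dimension, by means of which general position is
expressed. In a chart, each stratum has Hausdorff dimension at most its dimension as a submanifold, because it is locally the image of a piece of a coordinate subspace under a smooth, hence
locally Lipschitz, transition map (`IsSmoothSubmanifold.dimH_chart_image_le`). There are finitely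
many strata, so the whole complex has Hausdorff dimension at most `n - 2` in each chart; how the
strata meet is irrelevant. Hence the complement of `S` is dense.

Let `A` be a set of Hausdorff dimension less than `n - 1`, with open complement in a ball. Its
projection along the line through two points `a`, `b` has dense complement in the orthogonal
hyperplane, so an arbitrarily small translate of the segment `[a, b]` misses `A`, and its ends are
joined to `a` and `b` inside small balls (`Convex.joinedIn_diff_of_dimH_add_one_lt`). So `S`
separates no chart ball. A clopen argument (`JoinedIn.compl_of_mem_connectedComponent`) turns this
into: two points outside `S` in one connected component of `P` are joined by a path outside `S`.

Consequently the inclusion of the complement is bijective on path components. The zeroth homology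
of a space is a coproduct of copies of the coefficients indexed by its path components, naturally
in the space (`SSet.homologyMap_comp_homology₀Iso_hom`), which gives the isomorphism.
-/

/-! ### Zeroth homology and path components -/

section ZerothHomology

open Limits Simplicial

/-- Naturality of `SSet.homology₀Iso`: under the identification of `H₀` with a coproduct of copies
of the coefficients indexed by `π₀`, a map of simplicial sets acts through its action on `π₀`. -/
lemma SSet.homologyMap_comp_homology₀Iso_hom {A : Type*} [Category A] [HasCoproducts.{u} A]
    [Preadditive A] [CategoryWithHomology A] {X Y : SSet.{u}} (f : X ⟶ Y) (M : A) :
    SSet.homologyMap f M 0 ≫ (Y.homology₀Iso M).hom =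
      (X.homology₀Iso M).hom ≫ (sigmaConst.obj M).map (TypeCat.ofHom (SSet.mapπ₀ f)) := by
  rw [← cancel_epi ((X.chainComplex M).homologyπ 0),
    ← cancel_epi (inv ((X.chainComplex M).iCycles 0))]
  ext x
  -- the two sides are compared on the `0`-cycle given by the vertex `x`
  have key : X.ιChainComplex (R := M) x ≫ inv ((X.chainComplex M).iCycles 0) =
      (X.chainComplex M).liftCycles (X.ιChainComplex x) 0 (by simp) (by simp) := by
    rw [IsIso.comp_inv_eq, HomologicalComplex.liftCycles_i]
  have hx : (X.chainComplex M).liftCycles (X.ιChainComplex x) 0 (by simp) (by simp) ≫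
      HomologicalComplex.cyclesMap (SSet.chainComplexMap f M) 0 =
        (Y.chainComplex M).liftCycles (Y.ιChainComplex (f.app _ x)) 0 (by simp) (by simp) := by
    rw [← cancel_mono ((Y.chainComplex M).iCycles 0)]
    simp
  rw [reassoc_of% key, reassoc_of% key, HomologicalComplex.homologyπ_naturality_assoc,
    reassoc_of% hx, SSet.liftCycles_ιChainComplex_homologyπ_homology₀Iso_hom,
    SSet.liftCycles_ιChainComplex_homologyπ_homology₀Iso_hom_assoc]
  simp

lemma SSet.isIso_homologyMap_zero_of_bijective {A : Type*} [Category A] [HasCoproducts.{u} A]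
    [Preadditive A] [CategoryWithHomology A] {X Y : SSet.{u}} (f : X ⟶ Y) (M : A)
    (hf : Function.Bijective (SSet.mapπ₀ f)) : IsIso (SSet.homologyMap f M 0) := by
  have : IsIso (TypeCat.ofHom (SSet.mapπ₀ f)) := (isIso_iff_bijective _).2 hf
  have := SSet.homologyMap_comp_homology₀Iso_hom f M
  rw [← Iso.eq_comp_inv] at this
  rw [this]
  infer_instance

lemma Joined.of_zerothHomotopy_mk_eq {X : Type*} [TopologicalSpace X] {x y : X}
    (h : ZerothHomotopy.mk x = ZerothHomotopy.mk y) : Joined x y :=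
  Quotient.exact h

lemma TopCat.isIso_singularHomologyFunctor_zero_map {A : Type*} [Category A]
    [HasCoproducts.{u} A] [Preadditive A] [CategoryWithHomology A] {X Y : TopCat.{u}}
    (f : X ⟶ Y) (M : A) (hinj : ∀ a b : X, Joined (f a) (f b) → Joined a b)
    (hsurj : ∀ y : Y, ∃ a : X, Joined (f a) y) :
    IsIso (((singularHomologyFunctor A 0).obj M).map f) := by
  refine SSet.isIso_homologyMap_zero_of_bijective (TopCat.toSSet.map f) M ?_
  have hmk : ∀ x : X, SSet.mapπ₀ (TopCat.toSSet.map f) (TopCat.zerothHomotopyEquiv (.mk x)) =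
      TopCat.zerothHomotopyEquiv (.mk (f x)) := fun x ↦ rfl
  constructor
  · intro s t hst
    obtain ⟨a, rfl⟩ := TopCat.zerothHomotopyEquiv.surjective s
    obtain ⟨b, rfl⟩ := TopCat.zerothHomotopyEquiv.surjective t
    induction a with | mk a
    induction b with | mk b
    rw [hmk, hmk, TopCat.zerothHomotopyEquiv.apply_eq_iff_eq] at hst
    rw [ZerothHomotopy.sound (hinj a b (.of_zerothHomotopy_mk_eq hst)).somePath]
  · intro t
    obtain ⟨y, rfl⟩ := TopCat.zerothHomotopyEquiv.surjective t
    induction y with | mk y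
    obtain ⟨a, ha⟩ := hsurj y
    exact ⟨TopCat.zerothHomotopyEquiv (.mk a), by rw [hmk, ZerothHomotopy.sound ha.somePath]⟩

end ZerothHomology

/-! ### Sets of small Hausdorff dimension in convex open sets -/

/-- A set of codimension greater than one does not separate a convex open set. The segment from
`a` to `b` is translated by a small vector orthogonal to it: the projection of `A` along the
segment has dimension too small to contain a neighbourhood, so some translate misses `A`. -/
lemma Convex.joinedIn_diff_of_dimH_add_one_lt {E : Type*} [NormedAddCommGroup E]
    [InnerProductSpace ℝ E] [FiniteDimensional ℝ E] {B A : Set E} (hB : Convex ℝ B)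
    (hBA : IsOpen (B \ A)) (hA : A.Nonempty → dimH A + 1 < Module.finrank ℝ E)
    {a b : E} (ha : a ∈ B \ A) (hb : b ∈ B \ A) : JoinedIn (B \ A) a b := by
  rcases A.eq_empty_or_nonempty with rfl | hne
  · refine JoinedIn.of_segment_subset ?_
    rw [Set.sdiff_empty]
    exact hB.segment_subset ha.1 hb.1
  rcases eq_or_ne a b with rfl | hab
  · exact JoinedIn.refl ha
  set K : Submodule ℝ E := (ℝ ∙ (b - a))ᗮ with hK
  have hrank : Module.finrank ℝ K + 1 = Module.finrank ℝ E := by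
    have h1 := Submodule.finrank_add_finrank_orthogonal (ℝ ∙ (b - a))
    rw [finrank_span_singleton (sub_ne_zero.2 hab.symm), ← hK] at h1
    omega
  have hdense : Dense (K.orthogonalProjectionOnto '' A)ᶜ := by
    refine dense_compl_of_dimH_lt_finrank
      ((dimH_orthogonalProjectionOnto_le K A).trans_lt ?_)
    have h2 := hA hne
    rw [← hrank, Nat.cast_add, Nat.cast_one] at h2
    exact lt_of_add_lt_add_right h2
  obtain ⟨ε, hε, hεa⟩ := Metric.isOpen_iff.1 hBA a ha
  obtain ⟨δ, hδ, hδb⟩ := Metric.isOpen_iff.1 hBA b hb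
  obtain ⟨k, hk, hkd⟩ := hdense.exists_dist_lt (K.orthogonalProjectionOnto a) (lt_min hε hδ)
  set w : K := k - K.orthogonalProjectionOnto a with hw
  have hwn : ‖(w : E)‖ < min ε δ := by
    rwa [← Submodule.coe_norm, hw, ← dist_eq_norm, dist_comm]
  have hball : ∀ (c : E) (r : ℝ), min ε δ ≤ r → Metric.ball c r ⊆ B \ A → c ∈ B \ A →
      JoinedIn (B \ A) c (c + w) := by
    intro c r hr hc hcA
    refine JoinedIn.of_segment_subset (((convex_ball c r).segment_subset ?_ ?_).trans hc)
    · exact Metric.mem_ball_self ((lt_min hε hδ).trans_le hr)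
    · simpa using hwn.trans_le hr
  have hJa := hball a ε (min_le_left _ _) hεa ha
  have hJb := hball b δ (min_le_right _ _) hδb hb
  refine (hJa.trans (JoinedIn.of_segment_subset fun y hy ↦ ?_)).trans hJb.symm
  refine ⟨hB.segment_subset hJa.target_mem.1 hJb.target_mem.1 hy, fun hyA ↦ hk ⟨y, hyA, ?_⟩⟩
  rw [segment_eq_image'] at hy
  obtain ⟨t, -, rfl⟩ := hy
  have hba : K.orthogonalProjectionOnto (b - a) = 0 :=
    Submodule.orthogonalProjectionOnto_orthogonal_apply_eq_zero
      (Submodule.mem_span_singleton_self _)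
  have hsub : b + (w : E) - (a + w) = b - a := by abel
  simp only [hsub, map_add, map_smul, hba, smul_zero, add_zero,
    Submodule.orthogonalProjectionOnto_mem_subspace_eq_self]
  rw [hw]
  abel

/-! ### Dimension of submanifolds in charts -/

lemma dimH_setOf_coord_eq_zero_le (n d : ℕ) :
    dimH {v : EuclideanSpace ℝ (Fin n) | ∀ i : Fin n, d ≤ (i : ℕ) → v i = 0} ≤ d := by
  let f : (Fin d → ℝ) → EuclideanSpace ℝ (Fin n) := fun u ↦
    WithLp.toLp 2 fun i ↦ if h : (i : ℕ) < d then u ⟨i, h⟩ else 0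
  have hf : ContDiff ℝ 1 f := by
    rw [contDiff_euclidean]
    intro i
    by_cases h : (i : ℕ) < d
    · simpa [f, h] using contDiff_apply ℝ ℝ (⟨i, h⟩ : Fin d)
    · simpa [f, h] using contDiff_const
  have hr := hf.dimH_range_le
  rw [Module.finrank_fin_fun] at hr
  refine (dimH_mono fun v hv ↦ ?_).trans hr
  refine ⟨fun j ↦ if h : (j : ℕ) < n then v ⟨j, h⟩ else 0, ?_⟩
  ext i
  by_cases h : (i : ℕ) < d
  · simp [f, h]
  · simp [f, h, hv i (not_lt.1 h)]

section Charts

variable {n : ℕ} {P : Type*} [TopologicalSpace P] [ChartedSpace (EuclideanSpace ℝ (Fin n)) P]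

/-- In any smooth chart, a `d`-dimensional submanifold has Hausdorff dimension at most `d`: locally
it is the image of a piece of a `d`-dimensional coordinate subspace under a transition map, which
is locally Lipschitz. -/
lemma IsSmoothSubmanifold.dimH_chart_image_le [IsManifold (𝓡 n) ∞ P] {d : ℕ} {T : Set P}
    (hT : IsSmoothSubmanifold n d T)
    {φ : OpenPartialHomeomorph P (EuclideanSpace ℝ (Fin n))}
    (hφ : φ ∈ IsManifold.maximalAtlas (𝓡 n) ∞ P) : dimH (φ '' (T ∩ φ.source)) ≤ d := by
  by_contra! hlt
  obtain ⟨_, ⟨x, ⟨hxT, hxφ⟩, rfl⟩, hx⟩ := exists_mem_nhdsWithin_lt_dimH_of_lt_dimH hlt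
  obtain ⟨ψ, hψ, hxψ, hTψ⟩ := hT.2 x hxT
  refine (hx (φ '' (T ∩ φ.source) ∩ φ '' (φ.source ∩ ψ.source)) ?_).not_ge ?_
  · refine Filter.inter_mem self_mem_nhdsWithin (mem_nhdsWithin_of_mem_nhds ?_)
    exact φ.image_mem_nhds hxφ
      (Filter.inter_mem (φ.open_source.mem_nhds hxφ) (ψ.open_source.mem_nhds hxψ))
  · calc _ ≤ dimH ((φ ∘ ψ.symm) '' (ψ '' (T ∩ φ.source ∩ ψ.source))) := by
          refine dimH_mono ?_
          rintro _ ⟨⟨y, ⟨hyT, hyφ⟩, rfl⟩, ⟨z, ⟨hzφ, hzψ⟩, hz⟩⟩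
          obtain rfl := φ.injOn hzφ hyφ hz
          exact ⟨ψ z, ⟨z, ⟨⟨hyT, hyφ⟩, hzψ⟩, rfl⟩, by simp [ψ.left_inv hzψ]⟩
      _ ≤ dimH (ψ '' (T ∩ φ.source ∩ ψ.source)) := by
          refine dimH_image_le_of_locally_lipschitzOn ?_
          rintro _ ⟨y, ⟨⟨-, hyφ⟩, hyψ⟩, rfl⟩
          have h1 : ContMDiffAt (𝓡 n) (𝓡 n) ∞ (φ ∘ ψ.symm) (ψ y) := by
            refine ContMDiffAt.comp (ψ y) ?_
              (contMDiffAt_symm_of_mem_maximalAtlas hψ (ψ.map_source hyψ))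
            rw [ψ.left_inv hyψ]
            exact contMDiffAt_of_mem_maximalAtlas hφ hyφ
          obtain ⟨C, t, ht, hC⟩ :=
            (h1.contDiffAt.of_le (by simp : (1 : WithTop ℕ∞) ≤ ∞)).exists_lipschitzOnWith
          exact ⟨C, t, mem_nhdsWithin_of_mem_nhds ht, hC⟩
      _ ≤ _ := by
          refine dimH_mono ?_
          rintro _ ⟨y, ⟨⟨hyT, -⟩, hyψ⟩, rfl⟩
          exact (hTψ y hyψ).1 hyT
      _ ≤ d := dimH_setOf_coord_eq_zero_le n d

lemma SubmanifoldComplex.stratumDim_add_two_le {S : Set P} (C : SubmanifoldComplex n S)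
    (hC : C.dim + 2 ≤ (n : WithBot ℕ)) (i : Fin C.card) : C.stratumDim i + 2 ≤ n := by
  have h1 : (C.stratumDim i : WithBot ℕ) ≤ C.dim :=
    Finset.le_sup (f := fun i ↦ (C.stratumDim i : WithBot ℕ)) (Finset.mem_univ i)
  have h2 : (C.stratumDim i : WithBot ℕ) + 2 ≤ n := (by gcongr : _ ≤ C.dim + 2).trans hC
  exact_mod_cast h2

/-- The nonemptiness hypothesis is needed since `dimH ∅ = 0`, while the empty complex has
codimension at least two in every dimension `n`, including `n ≤ 1`. -/
lemma SubmanifoldComplex.dimH_chart_image_add_one_lt [IsManifold (𝓡 n) ∞ P] {S : Set P}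
    (C : SubmanifoldComplex n S) (hC : C.dim + 2 ≤ (n : WithBot ℕ))
    {φ : OpenPartialHomeomorph P (EuclideanSpace ℝ (Fin n))}
    (hφ : φ ∈ IsManifold.maximalAtlas (𝓡 n) ∞ P) (hne : (φ '' (S ∩ φ.source)).Nonempty) :
    dimH (φ '' (S ∩ φ.source)) + 1 < n := by
  have hn : 2 ≤ n := by
    obtain ⟨_, x, ⟨hxS, -⟩, -⟩ := hne
    rw [← C.iUnion_stratum, Set.mem_iUnion] at hxS
    obtain ⟨i, -⟩ := hxS
    have := C.stratumDim_add_two_le hC i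
    omega
  have hle : dimH (φ '' (S ∩ φ.source)) ≤ ((n - 2 : ℕ) : ENNReal) := by
    conv_lhs => rw [← C.iUnion_stratum]
    rw [Set.iUnion_inter, Set.image_iUnion, dimH_iUnion]
    refine iSup_le fun i ↦ ((C.isSmoothSubmanifold i).dimH_chart_image_le hφ).trans ?_
    have := C.stratumDim_add_two_le hC i
    exact_mod_cast (by omega : C.stratumDim i ≤ n - 2)
  refine (add_le_add_left hle 1).trans_lt ?_
  exact_mod_cast (by omega : n - 2 + 1 < n)

lemma SubmanifoldComplex.dense_compl [IsManifold (𝓡 n) ∞ P] {S : Set P}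
    (C : SubmanifoldComplex n S) (hC : C.dim + 2 ≤ (n : WithBot ℕ)) : Dense Sᶜ := by
  intro z
  rw [mem_closure_iff_nhds]
  intro V hV
  let φ := chartAt (EuclideanSpace ℝ (Fin n)) z
  have hz : z ∈ φ.source := mem_chart_source _ z
  have hd : Dense (φ '' (S ∩ φ.source))ᶜ := by
    rcases (φ '' (S ∩ φ.source)).eq_empty_or_nonempty with h | h
    · simp [h]
    · refine dense_compl_of_dimH_lt_finrank ?_
      rw [finrank_euclideanSpace_fin]
      exact le_self_add.trans_lt
        (C.dimH_chart_image_add_one_lt hC (IsManifold.chart_mem_maximalAtlas z) h)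
  have hN : φ '' (V ∩ φ.source) ∈ nhds (φ z) :=
    φ.image_mem_nhds hz (Filter.inter_mem hV (φ.open_source.mem_nhds hz))
  obtain ⟨_, hy, ⟨y, ⟨hyV, hyφ⟩, rfl⟩⟩ := hd.inter_nhds_nonempty hN
  exact ⟨y, hyV, fun hyS ↦ hy ⟨y, ⟨hyS, hyφ⟩, rfl⟩⟩

/-- A closed submanifold-complex of codimension at least two does not separate small neighbourhoods:
the inverse image of a ball in a chart has this property. -/
lemma SubmanifoldComplex.exists_mem_nhds_joinedIn_compl [IsManifold (𝓡 n) ∞ P] {S : Set P}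
    (hS : IsClosed S) (C : SubmanifoldComplex n S) (hC : C.dim + 2 ≤ (n : WithBot ℕ)) (z : P) :
    ∃ U ∈ nhds z, ∀ a ∈ U \ S, ∀ b ∈ U \ S, JoinedIn Sᶜ a b := by
  let φ := chartAt (EuclideanSpace ℝ (Fin n)) z
  have hz : z ∈ φ.source := mem_chart_source _ z
  obtain ⟨r, hr, hrφ⟩ := Metric.isOpen_iff.1 φ.open_target (φ z) (φ.map_source hz)
  set B := Metric.ball (φ z) r with hB
  set A := φ '' (S ∩ φ.source) with hA
  have hmem : ∀ v ∈ B \ A, φ.symm v ∈ Sᶜ := fun v hv hvS ↦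
    hv.2 ⟨φ.symm v, ⟨hvS, φ.map_target (hrφ hv.1)⟩, φ.right_inv (hrφ hv.1)⟩
  have hopen : IsOpen (B \ A) := by
    have : B \ A = B ∩ (φ.target ∩ φ.symm ⁻¹' Sᶜ) := by
      ext v
      refine ⟨fun hv ↦ ⟨hv.1, hrφ hv.1, hmem v hv⟩, fun ⟨hvB, _, hvS⟩ ↦ ⟨hvB, ?_⟩⟩
      rintro ⟨y, ⟨hyS, hyφ⟩, rfl⟩
      exact hvS (by rwa [φ.left_inv hyφ])
    rw [this]
    exact Metric.isOpen_ball.inter (φ.isOpen_inter_preimage_symm hS.isOpen_compl)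
  refine ⟨φ.source ∩ φ ⁻¹' B, Filter.inter_mem (φ.open_source.mem_nhds hz)
    ((φ.continuousAt hz).preimage_mem_nhds (Metric.ball_mem_nhds _ hr)), ?_⟩
  have hφA : ∀ a ∈ (φ.source ∩ φ ⁻¹' B) \ S, φ a ∈ B \ A := by
    rintro a ⟨⟨haφ, haB⟩, haS⟩
    refine ⟨haB, ?_⟩
    rintro ⟨y, ⟨hyS, hyφ⟩, hya⟩
    exact haS (φ.injOn hyφ haφ hya ▸ hyS)
  intro a ha b hb
  have hJ : JoinedIn (B \ A) (φ a) (φ b) := by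
    refine (convex_ball (φ z) r).joinedIn_diff_of_dimH_add_one_lt hopen (fun h ↦ ?_)
      (hφA a ha) (hφA b hb)
    rw [finrank_euclideanSpace_fin]
    exact C.dimH_chart_image_add_one_lt hC (IsManifold.chart_mem_maximalAtlas z) h
  have := hJ.map_continuousOn (φ.continuousOn_symm.mono fun v hv ↦ hrφ hv.1)
  rw [φ.left_inv ha.1.1, φ.left_inv hb.1.1] at this
  exact this.mono (Set.image_subset_iff.2 hmem)

end Charts

/-! ### From local to global -/

/-- A set with dense complement that separates no small neighbourhood separates no connected
component. -/
lemma JoinedIn.compl_of_mem_connectedComponent {X : Type*} [TopologicalSpace X] {S : Set X}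
    (hdense : Dense Sᶜ)
    (hloc : ∀ z, ∃ U ∈ nhds z, ∀ a ∈ U \ S, ∀ b ∈ U \ S, JoinedIn Sᶜ a b)
    {x y : X} (hx : x ∉ S) (hy : y ∉ S) (hxy : y ∈ connectedComponent x) :
    JoinedIn Sᶜ x y := by
  -- the points all of whose nearby points outside `S` can be reached from `x`
  let W : Set X := {z | ∀ᶠ w in nhds z, w ∉ S → JoinedIn Sᶜ x w}
  have hW : IsClopen W := by
    refine ⟨isClosed_of_closure_subset fun z hz ↦ ?_, isOpen_setOfPred_eventually_nhds⟩
    obtain ⟨U, hU, hUS⟩ := hloc z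
    obtain ⟨w, hwU, hwW⟩ := mem_closure_iff_nhds.1 hz _ (interior_mem_nhds.2 hU)
    have hN : U ∩ {w' | w' ∉ S → JoinedIn Sᶜ x w'} ∈ nhds w :=
      Filter.inter_mem (mem_interior_iff_mem_nhds.1 hwU) hwW
    obtain ⟨w', hw'S, hw'U, hw'⟩ := hdense.inter_nhds_nonempty hN
    filter_upwards [hU] with v hvU hvS
    exact (hw' hw'S).trans (hUS w' ⟨hw'U, hw'S⟩ v ⟨hvU, hvS⟩)
  have hxW : x ∈ W := by
    obtain ⟨U, hU, hUS⟩ := hloc x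
    filter_upwards [hU] with v hvU hvS
    exact hUS x ⟨mem_of_mem_nhds hU, hx⟩ v ⟨hvU, hvS⟩
  have hyW : y ∈ W := hW.connectedComponent_subset hxW hxy
  exact hyW.self_of_nhds hy

theorem mainTheorem9 {n : ℕ} {P : Type u} [TopologicalSpace P] [T2Space P]
    [ChartedSpace (EuclideanSpace ℝ (Fin n)) P] [IsManifold (𝓡 n) ∞ P]
    (S : Set P) (hS : IsClosed S) (C : SubmanifoldComplex n S)
    (hcodim : C.dim + 2 ≤ (n : WithBot ℕ)) :
    (∀ (R : Type v) [Ring R] (M : ModuleCat.{max u w} R),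
      IsIso (((singularHomologyFunctor (ModuleCat.{max u w} R) 0).obj M).map
        (complInclusion S))) ∧
    ∀ x : P, IsConnected (connectedComponent x \ S) := by
  have : LocallyPathConnectedSpace P :=
    ChartedSpace.locallyPathConnectedSpace (EuclideanSpace ℝ (Fin n)) P
  have hdense : Dense Sᶜ := C.dense_compl hcodim
  have hjoin : ∀ x y : P, x ∉ S → y ∉ S → y ∈ connectedComponent x → JoinedIn Sᶜ x y :=
    fun x y hx hy ↦ JoinedIn.compl_of_mem_connectedComponent hdense
      (C.exists_mem_nhds_joinedIn_compl hS hcodim) hx hy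
  have hne : ∀ x : P, ∃ a ∈ connectedComponent x, a ∉ S := fun x ↦
    hdense.inter_open_nonempty _ isOpen_connectedComponent ⟨x, mem_connectedComponent⟩
  refine ⟨fun R _ M ↦ ?_, fun x ↦ ?_⟩
  · refine TopCat.isIso_singularHomologyFunctor_zero_map _ M ?_ ?_
    · rintro ⟨a, ha⟩ ⟨b, hb⟩ (hab : Joined a b)
      exact (joinedIn_iff_joined ha hb).1
        (hjoin a b ha hb (pathComponent_subset_component a hab))
    · intro (y : P)
      obtain ⟨a, hay, haS⟩ := hne y
      rw [← pathComponent_eq_connectedComponent] at hay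
      exact ⟨⟨a, haS⟩, Joined.symm hay⟩
  · obtain ⟨a, hax, haS⟩ := hne x
    have heq : connectedComponent x \ S = pathComponentIn Sᶜ a := by
      rw [connectedComponent_eq hax]
      ext y
      exact ⟨fun hy ↦ hjoin a y haS hy.2 hy.1, fun hy ↦
        ⟨pathComponent_subset_component a hy.joined, hy.target_mem⟩⟩
    rw [heq]
    exact (isPathConnected_pathComponentIn haS).isConnected
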